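/- There is a universal constant $c>0$ such that the following holds. Let $n\ge d$ be natural numbers, $\gamma>1$, $\sigma\ge 0$ with $\sigma^2\le 2n\gamma^2/(d+1)$, and let $\lambda_1,\lambda_2>0$ with $\lambda_1+\lambda_2=1$. Let $\mathfrak X(\gamma)$ be the set of matrices $X\in\mathbb R^{n\times d}$ with $\gamma^{-1}I_d\preceq n^{-1}X^\top X\preceq\gamma I_d$, and let $\Gamma\subset\mathbb R^d$ be the set of $1$-sparse vectors (at most one nonzero coordinate). For fixed designs $X_1,X_2\in\mathfrak X(\gamma)$ and ground truths $\beta_1,\beta_2\in\Gamma$, one observes $y^k=X_k\beta_k+\xi^k$, $k\in\{1,2\}$, with independent noise vectors $\xi^1,\xi^2\sim\mathcal N(0,\sigma^2 I_n)$. Let $$\vartheta_\lambda=\operatorname*{arg\,min}_{\vartheta\in\mathbb R^d}\ \sum_{k=1}^2\frac{\lambda_k}{n}\|X_k(\vartheta-\beta_k)\|_2^2 .$$ Let $\rho:\mathbb R^d\to\mathbb R$ be any penalty, and let $\widehat\vartheta_\lambda$ be any directly regularized estimator with this penalty, that is, a measurable function of the responses $(y^1,y^2)$ for each pair of designs $X_1,X_2\in\mathfrak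 X(\gamma)$ with $$\widehat\vartheta_\lambda\in\operatorname*{arg\,min}_{\vartheta\in\mathbb R^d}\ \sum_{k=1}^2\frac{\lambda_k}{n}\|X_k\vartheta-y^k\|_2^2+\rho(\vartheta)$$ for all designs $X_1,X_2\in\mathfrak X(\gamma)$ and all responses. Then $$\sup_{\beta_1,\beta_2\in\Gamma,\ X_1,X_2\in\mathfrak X(\gamma)}\mathbb E\left[\|\widehat\vartheta_\lambda-\vartheta_\lambda\|_2^2\right]\ \ge\ c\,\frac{\sigma^2 d}{n\gamma}.$$ -/

import Mathlib

open MeasureTheory ProbabilityTheory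
open scoped ENNReal

namespace DirectReg

/-- `ℝ^m` with the Euclidean norm. -/
abbrev Vec (m : ℕ) : Type := EuclideanSpace ℝ (Fin m)

/-- The design class `𝔛(γ)`: real `n × d` matrices with `γ⁻¹ I ≼ n⁻¹ Xᵀ X ≼ γ I` in the
Loewner order. -/
def designClass (n d : ℕ) (γ : ℝ) : Set (Matrix (Fin n) (Fin d) ℝ) :=
  {X | ((n : ℝ)⁻¹ • (X.transpose * X) - γ⁻¹ • (1 : Matrix (Fin d) (Fin d) ℝ)).PosSemidef ∧
    (γ • (1 : Matrix (Fin d) (Fin d) ℝ) - (n : ℝ)⁻¹ • (X.transpose * X)).PosSemidef}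

/-- The set `Γ` of 1-sparse vectors: at most one coordinate is nonzero. -/
def oneSparse (d : ℕ) : Set (Vec d) :=
  {β | {i : Fin d | β i ≠ 0}.ncard ≤ 1}

/-- The population objective `n⁻¹ ‖X (ϑ - β)‖₂²`. -/
noncomputable def populationObjective {n d : ℕ} (X : Matrix (Fin n) (Fin d) ℝ) (β ϑ : Vec d) : ℝ :=
  (n : ℝ)⁻¹ * ‖X.toEuclideanLin (ϑ - β)‖ ^ 2

/-- The empirical objective `n⁻¹ ‖X ϑ - y‖₂²`. -/
noncomputable def empiricalObjective {n d : ℕ} (X : Matrix (Fin n) (Fin d) ℝ) (y : Vec n)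
    (ϑ : Vec d) : ℝ :=
  (n : ℝ)⁻¹ * ‖X.toEuclideanLin ϑ - y‖ ^ 2

/-- The minimizers over `ℝ^d` of the linear scalarization `∑ k, w k * L_k` of the two population
objectives (a singleton when both designs lie in `𝔛(γ)` and the weights are in the simplex). -/
def populationMinimizers {n d : ℕ} (w : Fin 2 → ℝ) (X : Fin 2 → Matrix (Fin n) (Fin d) ℝ)
    (β : Fin 2 → Vec d) : Set (Vec d) :=
  {ϑ | IsMinOn (fun η => ∑ k, w k * populationObjective (X k) (β k) η) Set.univ ϑ}

/-- The minimizers over `ℝ^d` of the linear scalarization of the two empirical objectives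
plus the penalty `ρ`. -/
def penalizedMinimizers {n d : ℕ} (w : Fin 2 → ℝ) (ρ : Vec d → ℝ)
    (X : Fin 2 → Matrix (Fin n) (Fin d) ℝ) (y : Fin 2 → Vec n) : Set (Vec d) :=
  {ϑ | IsMinOn (fun η => ∑ k, w k * empiricalObjective (X k) (y k) η + ρ η) Set.univ ϑ}

/-- `est`, a function of the data (designs and responses), is a directly regularized estimator
with penalty `ρ`: for all designs in `𝔛(γ)` it is measurable in the responses and always returns a
minimizer of the penalized scalarized empirical objective. -/
structure IsDirectlyRegularized {n d : ℕ} (γ : ℝ) (w : Fin 2 → ℝ) (ρ : Vec d → ℝ)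
    (est : (Fin 2 → Matrix (Fin n) (Fin d) ℝ) → (Fin 2 → Vec n) → Vec d) : Prop where
  measurable : ∀ X : Fin 2 → Matrix (Fin n) (Fin d) ℝ, (∀ k, X k ∈ designClass n d γ) →
    Measurable (est X)
  minimizes : ∀ X : Fin 2 → Matrix (Fin n) (Fin d) ℝ, (∀ k, X k ∈ designClass n d γ) →
    ∀ y : Fin 2 → Vec n, est X y ∈ penalizedMinimizers w ρ X y

/-- The joint law of two independent noise vectors, each distributed as `N(0, σ² I_n)`. -/
noncomputable def noiseLaw (n : ℕ) (σ : ℝ) : Measure (Fin 2 → Vec n) :=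
  Measure.pi fun _ => multivariateGaussian 0 (σ ^ 2 • (1 : Matrix (Fin n) (Fin n) ℝ))

/-- The responses `y k = X k * β k + ξ k`. -/
noncomputable def responses {n d : ℕ} (X : Fin 2 → Matrix (Fin n) (Fin d) ℝ) (β : Fin 2 → Vec d)
    (ξ : Fin 2 → Vec n) : Fin 2 → Vec n :=
  fun k => (X k).toEuclideanLin (β k) + ξ k

/-- The expected squared error of the estimator `est` of `ϑ`, with values in `[0, ∞]`. -/
noncomputable def mse {n d : ℕ} (σ : ℝ)
    (est : (Fin 2 → Matrix (Fin n) (Fin d) ℝ) → (Fin 2 → Vec n) → Vec d)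
    (X : Fin 2 → Matrix (Fin n) (Fin d) ℝ) (β : Fin 2 → Vec d) (ϑ : Vec d) : ℝ≥0∞ :=
  ∫⁻ ξ, ‖est X (responses X β ξ) - ϑ‖ₑ ^ 2 ∂(noiseLaw n σ)

end DirectReg

/-! When the weighted Gram matrices average to the identity, the penalized objective equals `‖η‖ ^ 2
- 2 * ⟪η, v⟫ + ρ η` plus a constant, where `v` is the cross moment of designs and responses. Direct
regularization then sees the data only through `v`, and `v` is the population minimizer plus noise.

Sparsity of the ground truths does not constrain that minimizer. For Gram matrices `n • (1 ± O(ε)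
P)`, opposite 1-sparse vectors of size `1/ε` cancel except along `P` and reach any prescribed `ϑ`
(`exists_oneSparse_crossMoment_eq`). As `ε → 0` the designs become isotropic, and the estimator
faces a Gaussian location model on all of `ℝ^d` with per-coordinate variance `σ² ∑ w k ^ 2 / n ≥ σ²
/ (2n)`. Exchanging signal and noise shows that no estimator beats half the total variance
(`lintegral_enorm_sq_le_two_mul_of_forall_risk_le`).

Since `ρ` is arbitrary, minimizers may be non-unique and discontinuous in `v`. They are, however,
subgradients of a convex function of `v`, which is differentiable almost everywhere. This gives
almost sure convergence as `ε → 0` (`ae_tendsto_minimizers`), and Fatou's lemma passes to the limit.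
-/

open Filter Topology RealInnerProductSpace

/-! ### Almost everywhere continuity of penalized minimizers -/

section Convex

variable {E : Type*} [NormedAddCommGroup E] [InnerProductSpace ℝ E]

/-- Subgradients taken at points converging to a point of differentiability converge to the
gradient there. -/
theorem tendsto_subgradient_of_hasGradientAt [CompleteSpace E] {f : E → ℝ} {v D : E}
    (hd : HasGradientAt f D v) {u s : ℕ → E} (hu : Tendsto u atTop (𝓝 v))
    (hs : ∀ m w, f (u m) + ⟪s m, w - u m⟫ ≤ f w) : Tendsto s atTop (𝓝 D) := by
  rw [Metric.tendsto_nhds]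
  intro e he
  have h1 := hasGradientAt_iff_isLittleO.1 hd
  obtain ⟨r, hr, hball⟩ := Metric.eventually_nhds_iff.1 (h1.def (c := e / 8) (by positivity))
  have hc : Tendsto (fun m => |f v - f (u m)| + ‖D‖ * ‖u m - v‖) atTop (𝓝 0) := by
    have h2 : Tendsto (fun m => f (u m)) atTop (𝓝 (f v)) :=
      (hd.differentiableAt.continuousAt.tendsto).comp hu
    have h3 : Tendsto (fun m => ‖u m - v‖) atTop (𝓝 0) := by
      simpa using (hu.sub_const v).norm
    simpa using ((h2.const_sub (f v)).abs).add (h3.const_mul ‖D‖)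
  have hn : Tendsto (fun m => ‖u m - v‖) atTop (𝓝 0) := by
    simpa using (hu.sub_const v).norm
  filter_upwards [hc.eventually (gt_mem_nhds (show (0 : ℝ) < e * r / 16 by positivity)),
    hn.eventually (gt_mem_nhds (show (0 : ℝ) < r / 4 by positivity))] with m hm1 hm2
  rw [dist_eq_norm]
  rcases eq_or_ne (s m) D with h | h
  · simpa [h] using he
  have hX : 0 < ‖s m - D‖ := norm_pos_iff.2 (sub_ne_zero.2 h)
  set X := ‖s m - D‖ with hXdef
  -- Testing the subgradient inequality in the direction of `s m - D` gains `r / 2 * X`. The offset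
  -- `u m - v` costs at most `r / 4 * X`, and the remaining errors total less than `e * r / 8`.
  set z : E := (r / 2 / X) • (s m - D) with hz
  have hzn : ‖z‖ = r / 2 := by
    rw [hz, norm_smul, Real.norm_of_nonneg (by positivity), ← hXdef]
    field_simp
  have hb := hball (y := v + z) (by rw [dist_eq_norm]; simp [hzn]; linarith)
  rw [add_sub_cancel_left, hzn, Real.norm_eq_abs] at hb
  have hb' := (abs_le.1 hb).2
  have hsub := hs m (v + z)
  have e1 : ⟪s m, v + z - u m⟫ = ⟪s m - D, z⟫ + ⟪D, z⟫ - ⟪s m - D, u m - v⟫ - ⟪D, u m - v⟫ := by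
    simp only [inner_sub_left, inner_sub_right, inner_add_right]; ring
  have e2 : ⟪s m - D, z⟫ = r / 2 * X := by
    rw [hz, inner_smul_right, real_inner_self_eq_norm_sq, ← hXdef]
    field_simp
  have e3 := real_inner_le_norm (s m - D) (u m - v)
  have e4 := real_inner_le_norm D (u m - v)
  have e5 := le_abs_self (f v - f (u m))
  have e6 : X * ‖u m - v‖ ≤ X * (r / 4) := by gcongr
  rw [← hXdef] at e3
  rw [e1, e2] at hsub
  have : r * X < r * e := by nlinarith
  exact lt_of_mul_lt_mul_left this hr.le

/-- Rademacher's theorem applies near each point, and countably many such neighbourhoods cover `E`.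
-/
theorem LocallyLipschitz.ae_differentiableAt [FiniteDimensional ℝ E] [MeasurableSpace E]
    [BorelSpace E] {f : E → ℝ} (hf : LocallyLipschitz f) (μ : Measure E) [μ.IsAddHaarMeasure] :
    ∀ᵐ v ∂μ, DifferentiableAt ℝ f v := by
  have key : ∀ x : E, ∃ U ∈ 𝓝 x, ∀ᵐ v ∂μ, v ∈ U → DifferentiableAt ℝ f v := by
    intro x
    obtain ⟨K, t, ht, hK⟩ := hf x
    refine ⟨interior t, interior_mem_nhds.2 ht, ?_⟩
    filter_upwards [hK.ae_differentiableWithinAt_of_mem (μ := μ)] with v hv hvt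
    exact (hv (interior_subset hvt)).differentiableAt (mem_interior_iff_mem_nhds.1 hvt)
  choose U hU hUd using key
  obtain ⟨S, hS, hcov⟩ := TopologicalSpace.countable_cover_nhds hU
  have := (ae_ball_iff hS).2 (fun x _ => hUd x)
  filter_upwards [this] with v hv
  have hvm : v ∈ ⋃ x ∈ S, U x := hcov ▸ Set.mem_univ v
  simp only [Set.mem_iUnion] at hvm
  obtain ⟨x, hx, hxU⟩ := hvm
  exact hv x hx hxU

/-- Minimizers of `η ↦ ‖η‖² - 2 ⟪η, v⟫ + ρ η` depend continuously on `v` at almost every `v`. -/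
theorem ae_tendsto_minimizers [FiniteDimensional ℝ E] [MeasurableSpace E] [BorelSpace E]
    (μ : Measure E) [μ.IsAddHaarMeasure] (ρ : E → ℝ) (S : E → E)
    (hS : ∀ v, IsMinOn (fun η => ‖η‖ ^ 2 - 2 * ⟪η, v⟫ + ρ η) Set.univ (S v)) :
    ∀ᵐ v ∂μ, ∀ u s : ℕ → E, Tendsto u atTop (𝓝 v) →
      (∀ m, IsMinOn (fun η => ‖η‖ ^ 2 - 2 * ⟪η, u m⟫ + ρ η) Set.univ (s m)) →
      Tendsto s atTop (𝓝 (S v)) := by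
  -- The convex conjugate of `(‖·‖² + ρ) / 2`: a supremum of affine functions of `v`, attained at `S
  -- v`. Any minimizer at `v` is a subgradient of `g` there.
  set g : E → ℝ := fun v => ⟪S v, v⟫ - (‖S v‖ ^ 2 + ρ (S v)) / 2 with hg
  have hle : ∀ v p, ⟪p, v⟫ - (‖p‖ ^ 2 + ρ p) / 2 ≤ g v := by
    intro v p
    have := isMinOn_iff.1 (hS v) p (Set.mem_univ _)
    simp only [hg]; linarith
  have hconv : ConvexOn ℝ Set.univ g := by
    refine ⟨convex_univ, fun x _ y _ a b ha hb hab => ?_⟩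
    have hx := hle x (S (a • x + b • y))
    have hy := hle y (S (a • x + b • y))
    have h1 := mul_le_mul_of_nonneg_left hx ha
    have h2 := mul_le_mul_of_nonneg_left hy hb
    simp only [smul_eq_mul]
    refine le_trans (le_of_eq ?_) (add_le_add h1 h2)
    simp only [hg, inner_add_right, inner_smul_right]
    linear_combination (‖S (a • x + b • y)‖ ^ 2 + ρ (S (a • x + b • y))) / 2 * hab
  have hsubg : ∀ u p, IsMinOn (fun η => ‖η‖ ^ 2 - 2 * ⟪η, u⟫ + ρ η) Set.univ p →
      ∀ w, g u + ⟪p, w - u⟫ ≤ g w := by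
    intro u p hp w
    have h1 := isMinOn_iff.1 hp (S u) (Set.mem_univ _)
    have h2 := hle w p
    rw [inner_sub_right]
    simp only [hg] at h2 ⊢
    linarith
  filter_upwards [hconv.locallyLipschitz.ae_differentiableAt μ] with v hv u s hu hs
  have hgrad := hv.hasGradientAt
  have h1 := tendsto_subgradient_of_hasGradientAt hgrad hu (fun m => hsubg _ _ (hs m))
  have h2 := tendsto_subgradient_of_hasGradientAt hgrad (u := fun _ => v) (s := fun _ => S v)
    tendsto_const_nhds (fun m => hsubg _ _ (hS v))
  rwa [tendsto_nhds_unique tendsto_const_nhds h2]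

end Convex

/-! ### Bayes lower bound by exchanging signal and noise -/

section LowerBound

theorem enorm_sub_sq_add_enorm_add_sq {E : Type*} [NormedAddCommGroup E] [InnerProductSpace ℝ E] (x y : E) :
    ‖x - y‖ₑ ^ 2 + ‖x + y‖ₑ ^ 2 = 2 * (‖x‖ₑ ^ 2 + ‖y‖ₑ ^ 2) := by
  have h := parallelogram_law_with_norm ℝ x y
  simp only [← ofReal_norm]
  rw [← ENNReal.ofReal_pow (norm_nonneg _), ← ENNReal.ofReal_pow (norm_nonneg _),
    ← ENNReal.ofReal_pow (norm_nonneg _), ← ENNReal.ofReal_pow (norm_nonneg _),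
    ← ENNReal.ofReal_add (by positivity) (by positivity),
    ← ENNReal.ofReal_add (by positivity) (by positivity),
    show (2 : ℝ≥0∞) = ENNReal.ofReal 2 by simp, ← ENNReal.ofReal_mul (by positivity)]
  congr 1
  linarith

theorem enorm_sub_sq_le {E : Type*} [NormedAddCommGroup E] [InnerProductSpace ℝ E] (a x y : E) :
    ‖x - y‖ₑ ^ 2 ≤ 2 * (‖a - x‖ₑ ^ 2 + ‖a - y‖ₑ ^ 2) := by
  rw [← enorm_sub_sq_add_enorm_add_sq, sub_sub_sub_cancel_left, enorm_sub_rev x y]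
  exact le_self_add

variable {E : Type*} [NormedAddCommGroup E] [InnerProductSpace ℝ E] [FiniteDimensional ℝ E]
  [MeasurableSpace E] [BorelSpace E]

/-- If the parameter has the same symmetric law `μ` as the additive noise, exchanging the two
leaves the observation unchanged, so no estimator beats half the second moment of `μ`. -/
theorem lintegral_enorm_sq_le_two_mul_of_forall_risk_le (μ : Measure E) [IsProbabilityMeasure μ]
    (hsymm : μ.map (fun x => -x) = μ) {T : E → E} (hT : Measurable T) {B : ℝ≥0∞}
    (hB : ∀ x, ∫⁻ y, ‖T (x + y) - x‖ₑ ^ 2 ∂μ ≤ B) :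
    ∫⁻ x, ‖x‖ₑ ^ 2 ∂μ ≤ 2 * B := by
  set M := ∫⁻ x, ‖x‖ₑ ^ 2 ∂μ
  have h1 : ∫⁻ x, ∫⁻ y, ‖T (x + y) - x‖ₑ ^ 2 ∂μ ∂μ ≤ B := by
    refine (lintegral_mono hB).trans ?_
    simp
  -- `x + y` is symmetric in `x` and `y`, so `T` estimates the noise as well as it estimates the
  -- signal.
  have h2 : ∫⁻ x, ∫⁻ y, ‖T (x + y) - y‖ₑ ^ 2 ∂μ ∂μ ≤ B := by
    rw [lintegral_lintegral_swap (by fun_prop)]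
    simpa only [add_comm] using h1
  have h3 : ∀ x : E, 2 * ∫⁻ y, ‖x - y‖ₑ ^ 2 ∂μ = 2 * (‖x‖ₑ ^ 2 + M) := by
    intro x
    -- Symmetry of `μ` and the parallelogram law together replace the vanishing of the cross term.
    have e : ∫⁻ y, ‖x + y‖ₑ ^ 2 ∂μ = ∫⁻ y, ‖x - y‖ₑ ^ 2 ∂μ := by
      conv_lhs => rw [← hsymm]
      rw [lintegral_map (by fun_prop) (by fun_prop)]
      simp only [sub_eq_add_neg]
    rw [two_mul]
    nth_rw 2 [← e]
    rw [← lintegral_add_left (by fun_prop)]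
    simp_rw [enorm_sub_sq_add_enorm_add_sq]
    rw [lintegral_const_mul _ (by fun_prop), lintegral_add_left (by fun_prop)]
    simp [M]
  have h4 : 2 * ∫⁻ x, ∫⁻ y, ‖x - y‖ₑ ^ 2 ∂μ ∂μ = 2 * (M + M) := by
    rw [← lintegral_const_mul _ (by fun_prop)]
    simp_rw [h3]
    rw [lintegral_const_mul _ (by fun_prop), lintegral_add_left (by fun_prop)]
    simp [M]
  have h5 : ∫⁻ x, ∫⁻ y, ‖x - y‖ₑ ^ 2 ∂μ ∂μ ≤ 2 * (B + B) := by
    calc ∫⁻ x, ∫⁻ y, ‖x - y‖ₑ ^ 2 ∂μ ∂μ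
        ≤ ∫⁻ x, ∫⁻ y, 2 * (‖T (x + y) - x‖ₑ ^ 2 + ‖T (x + y) - y‖ₑ ^ 2) ∂μ ∂μ :=
          lintegral_mono fun x => lintegral_mono fun y => enorm_sub_sq_le _ _ _
      _ = 2 * (∫⁻ x, ∫⁻ y, ‖T (x + y) - x‖ₑ ^ 2 ∂μ ∂μ
            + ∫⁻ x, ∫⁻ y, ‖T (x + y) - y‖ₑ ^ 2 ∂μ ∂μ) := by
          rw [← lintegral_add_left (by fun_prop), ← lintegral_const_mul _ (by fun_prop)]
          congr with x
          rw [← lintegral_add_left (by fun_prop), ← lintegral_const_mul _ (by fun_prop)]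
      _ ≤ 2 * (B + B) := by gcongr
  have h6 := mul_le_mul_right h5 2
  rw [h4] at h6
  have h7 : M + M ≤ 2 * (B + B) :=
    (ENNReal.mul_le_mul_iff_right (by simp) (by simp)).1 h6
  rw [← two_mul, ← two_mul] at h7
  exact (ENNReal.mul_le_mul_iff_right (by simp) (by simp)).1 h7

end LowerBound

/-! ### Standard Gaussian: absolute continuity and second moment -/

section Gaussian

theorem MeasureTheory.Measure.pi_fin_absolutelyContinuous {d : ℕ} {μ ν : Fin d → Measure ℝ}
    [∀ i, SigmaFinite (μ i)] [∀ i, SigmaFinite (ν i)] (h : ∀ i, μ i ≪ ν i) :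
    Measure.pi μ ≪ Measure.pi ν := by
  induction d with
  | zero =>
    rw [Measure.pi_of_empty, Measure.pi_of_empty]
  | succ d ih =>
    have h1 := (measurePreserving_piFinSuccAbove μ 0).symm
    have h2 := (measurePreserving_piFinSuccAbove ν 0).symm
    rw [← h1.map_eq, ← h2.map_eq]
    exact ((h 0).prod (ih fun i => h _)).map (MeasurableEquiv.measurable _)

theorem stdGaussian_absolutelyContinuous (d : ℕ) :
    stdGaussian (EuclideanSpace ℝ (Fin d)) ≪ volume := by
  rw [← map_pi_eq_stdGaussian, ← (PiLp.volume_preserving_toLp (Fin d)).map_eq]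
  exact (Measure.pi_fin_absolutelyContinuous fun _ =>
    gaussianReal_absolutelyContinuous 0 one_ne_zero).map (by fun_prop)

theorem lintegral_enorm_sq_gaussianReal_zero_one :
    ∫⁻ x, ‖x‖ₑ ^ 2 ∂(gaussianReal 0 1) = 1 := by
  have h := variance_id_gaussianReal (μ := 0) (v := 1)
  have h2 := (memLp_id_gaussianReal (μ := 0) (v := 1) 2).ofReal_variance_eq
  rw [evariance, h] at h2
  simpa using h2.symm

theorem lintegral_enorm_sq_stdGaussian (d : ℕ) :
    ∫⁻ x, ‖x‖ₑ ^ 2 ∂(stdGaussian (EuclideanSpace ℝ (Fin d))) = d := by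
  have h : ∀ x : EuclideanSpace ℝ (Fin d), ‖x‖ₑ ^ 2 = ∑ i, ‖x i‖ₑ ^ 2 := by
    intro x
    simp only [← ofReal_norm, ← ENNReal.ofReal_pow (norm_nonneg _)]
    rw [EuclideanSpace.norm_sq_eq, ENNReal.ofReal_sum_of_nonneg (fun _ _ => by positivity)]
  simp_rw [h]
  rw [lintegral_finsetSum _ (fun i _ => by fun_prop)]
  have h1 : ∀ i : Fin d, ∫⁻ x : EuclideanSpace ℝ (Fin d), ‖x i‖ₑ ^ 2 ∂(stdGaussian _) = 1 := by
    intro i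
    rw [← multivariateGaussian_zero_one]
    have := (measurePreserving_eval_multivariateGaussian (ι := Fin d) (μ := 0)
      Matrix.PosSemidef.one (i := i))
    rw [this.lintegral_comp (f := fun t : ℝ => ‖t‖ₑ ^ 2) (by fun_prop)]
    simpa using lintegral_enorm_sq_gaussianReal_zero_one
  simp [h1]

end Gaussian

namespace DirectReg

/-! ### Objectives under an averaged identity Gram matrix -/

section Objectives

variable {n d : ℕ}

theorem inner_toEuclideanLin_left (X : Matrix (Fin n) (Fin d) ℝ) (η : Vec d) (y : Vec n) :
    ⟪X.toEuclideanLin η, y⟫ = ⟪η, X.transpose.toEuclideanLin y⟫ := by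
  rw [← Matrix.conjTranspose_eq_transpose_of_trivial, Matrix.toEuclideanLin_conjTranspose_eq_adjoint,
    LinearMap.adjoint_inner_right]

theorem toEuclideanLin_mul_apply {m : ℕ} (X : Matrix (Fin n) (Fin d) ℝ)
    (Y : Matrix (Fin d) (Fin m) ℝ) (v : Vec m) :
    (X * Y).toEuclideanLin v = X.toEuclideanLin (Y.toEuclideanLin v) := by
  ext i
  simp [Matrix.toLpLin_apply, Matrix.mulVec_mulVec]

/-- The weighted cross moment `∑ k, w k n⁻¹ (X k)ᵀ y k` of designs and responses. -/
noncomputable def crossMoment (w : Fin 2 → ℝ) (X : Fin 2 → Matrix (Fin n) (Fin d) ℝ) :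
    (Fin 2 → Vec n) →ₗ[ℝ] Vec d :=
  ∑ k, (w k * (n : ℝ)⁻¹) • ((X k).transpose.toEuclideanLin ∘ₗ LinearMap.proj k)

theorem crossMoment_apply (w : Fin 2 → ℝ) (X : Fin 2 → Matrix (Fin n) (Fin d) ℝ)
    (y : Fin 2 → Vec n) :
    crossMoment w X y = ∑ k, (w k * (n : ℝ)⁻¹) • (X k).transpose.toEuclideanLin (y k) := by
  simp [crossMoment]

theorem sum_empiricalObjective {w : Fin 2 → ℝ} {X : Fin 2 → Matrix (Fin n) (Fin d) ℝ}
    (hX : ∑ k, (w k * (n : ℝ)⁻¹) • ((X k).transpose * X k) = 1) (y : Fin 2 → Vec n) (η : Vec d) :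
    ∑ k, w k * empiricalObjective (X k) (y k) η =
      ‖η‖ ^ 2 - 2 * ⟪η, crossMoment w X y⟫ + ∑ k, w k * ((n : ℝ)⁻¹ * ‖y k‖ ^ 2) := by
  have h1 : ‖η‖ ^ 2 = ∑ k, w k * ((n : ℝ)⁻¹ * ‖(X k).toEuclideanLin η‖ ^ 2) := by
    have h2 : ⟪η, (1 : Matrix (Fin d) (Fin d) ℝ).toEuclideanLin η⟫ = ‖η‖ ^ 2 := by
      simp
    rw [← h2, ← hX, map_sum, LinearMap.sum_apply, inner_sum]
    refine Finset.sum_congr rfl fun k _ => ?_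
    rw [map_smul, LinearMap.smul_apply, toEuclideanLin_mul_apply, inner_smul_right,
      ← inner_toEuclideanLin_left, real_inner_self_eq_norm_sq, mul_assoc]
  rw [h1, crossMoment_apply, inner_sum, Finset.mul_sum, ← Finset.sum_sub_distrib,
    ← Finset.sum_add_distrib]
  refine Finset.sum_congr rfl fun k _ => ?_
  rw [empiricalObjective, norm_sub_sq_real, inner_toEuclideanLin_left, inner_smul_right]
  ring

theorem mem_penalizedMinimizers_iff {w : Fin 2 → ℝ} {X : Fin 2 → Matrix (Fin n) (Fin d) ℝ}
    (hX : ∑ k, (w k * (n : ℝ)⁻¹) • ((X k).transpose * X k) = 1) (ρ : Vec d → ℝ)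
    (y : Fin 2 → Vec n) (ϑ : Vec d) :
    ϑ ∈ penalizedMinimizers w ρ X y ↔
      IsMinOn (fun η => ‖η‖ ^ 2 - 2 * ⟪η, crossMoment w X y⟫ + ρ η) Set.univ ϑ := by
  simp only [penalizedMinimizers, Set.mem_ofPred_eq, isMinOn_iff, sum_empiricalObjective hX]
  refine forall₂_congr fun η _ => ?_
  constructor <;> intro h <;> linarith

/-- The population objective is the empirical one at noiseless responses, so completing the square
gives the minimizer. -/
theorem crossMoment_mem_populationMinimizers {w : Fin 2 → ℝ}
    {X : Fin 2 → Matrix (Fin n) (Fin d) ℝ}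
    (hX : ∑ k, (w k * (n : ℝ)⁻¹) • ((X k).transpose * X k) = 1) (β : Fin 2 → Vec d) :
    crossMoment w X (fun k => (X k).toEuclideanLin (β k)) ∈ populationMinimizers w X β := by
  have h : ∀ k η, populationObjective (X k) (β k) η =
      empiricalObjective (X k) ((X k).toEuclideanLin (β k)) η := by
    intro k η
    rw [populationObjective, empiricalObjective, map_sub]
  simp only [populationMinimizers, Set.mem_ofPred_eq, isMinOn_iff, h]
  intro η _
  rw [sum_empiricalObjective hX (fun k => (X k).toEuclideanLin (β k)),
    sum_empiricalObjective hX (fun k => (X k).toEuclideanLin (β k))]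
  set v := crossMoment w X (fun k => (X k).toEuclideanLin (β k))
  have h1 := norm_sub_sq_real η v
  have h2 := sq_nonneg ‖η - v‖
  rw [real_inner_self_eq_norm_sq]
  linarith

end Objectives

/-! ### Rank-one perturbations of the isotropic design -/

section Designs

variable {n d : ℕ}

/-- The `n × d` matrix with ones on the main diagonal and zeros elsewhere. -/
def partialIdentity (n d : ℕ) : Matrix (Fin n) (Fin d) ℝ :=
  Matrix.of fun i j => if i.val = j.val then 1 else 0

theorem partialIdentity_transpose_mul_self (h : d ≤ n) :
    (partialIdentity n d).transpose * partialIdentity n d = 1 := by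
  ext i j
  rw [Matrix.mul_apply, Finset.sum_eq_single (Fin.castLE h i)]
  · simp [partialIdentity, Matrix.one_apply, Fin.ext_iff]
  · intro b _ hb
    have : b.val ≠ i.val := fun hh => hb (Fin.ext hh)
    simp [partialIdentity, this]
  · simp

/-- A design whose Gram matrix is `n • (1 + s • P)` when `P` is an orthogonal projection. -/
noncomputable def spikedDesign (n : ℕ) (P : Matrix (Fin d) (Fin d) ℝ) (s : ℝ) :
    Matrix (Fin n) (Fin d) ℝ :=
  √n • (partialIdentity n d * (1 + (√(1 + s) - 1) • P))

theorem spikedDesign_gram (h : d ≤ n) {P : Matrix (Fin d) (Fin d) ℝ} (hPt : P.transpose = P)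
    (hP : P * P = P) {s : ℝ} (hs : -1 ≤ s) :
    (spikedDesign n P s).transpose * spikedDesign n P s = (n : ℝ) • (1 + s • P) := by
  obtain ⟨r, hr⟩ : ∃ r, √(1 + s) - 1 = r := ⟨_, rfl⟩
  -- This is what makes `(1 + r • P) ^ 2 = 1 + s • P` for idempotent `P`.
  have hrs : r + r + r * r = s := by
    have := Real.mul_self_sqrt (show 0 ≤ 1 + s by linarith)
    rw [← hr]; linarith
  rw [spikedDesign, hr, Matrix.transpose_smul, Matrix.transpose_mul, Matrix.smul_mul, Matrix.mul_smul,
    smul_smul, Real.mul_self_sqrt (Nat.cast_nonneg n), Matrix.mul_assoc,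
    ← Matrix.mul_assoc (partialIdentity n d).transpose, partialIdentity_transpose_mul_self h,
    Matrix.one_mul, Matrix.transpose_add, Matrix.transpose_one, Matrix.transpose_smul, hPt,
    Matrix.add_mul, Matrix.mul_add, Matrix.mul_add, Matrix.smul_mul, Matrix.mul_smul, Matrix.one_mul,
    Matrix.one_mul, Matrix.mul_one, Matrix.smul_mul, Matrix.mul_smul, hP, smul_smul, ← hrs]
  congr 1
  simp only [add_smul]
  abel

theorem posSemidef_smul_one_add_smul {P : Matrix (Fin d) (Fin d) ℝ} (hPt : P.transpose = P)
    (hP : P * P = P) {c s : ℝ} (h : |s| ≤ c) :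
    (c • (1 : Matrix (Fin d) (Fin d) ℝ) + s • P).PosSemidef := by
  have h1 : P.PosSemidef := by
    have := Matrix.posSemidef_conjTranspose_mul_self P
    rwa [Matrix.conjTranspose_eq_transpose_of_trivial, hPt, hP] at this
  have h2 : (1 - P).PosSemidef := by
    have := Matrix.posSemidef_conjTranspose_mul_self (1 - P)
    rwa [Matrix.conjTranspose_eq_transpose_of_trivial, Matrix.transpose_sub, Matrix.transpose_one,
      hPt, Matrix.sub_mul, Matrix.mul_sub, Matrix.mul_sub, hP, Matrix.one_mul, Matrix.mul_one,
      sub_self, sub_zero, Matrix.one_mul] at this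
  have hs := abs_le.1 h
  have e : c • (1 : Matrix (Fin d) (Fin d) ℝ) + s • P = c • (1 - P) + (c + s) • P := by
    rw [smul_sub, add_smul]; abel
  rw [e]
  exact (h2.smul (by linarith [abs_nonneg s])).add (h1.smul (by linarith))

theorem spikedDesign_mem_designClass (h : d ≤ n) (hn : 0 < n) {P : Matrix (Fin d) (Fin d) ℝ}
    (hPt : P.transpose = P) (hP : P * P = P) {γ s : ℝ} (hγ : 1 < γ) (hs : |s| ≤ 1 - γ⁻¹) :
    spikedDesign n P s ∈ designClass n d γ := by
  have hγ0 : 0 < γ⁻¹ := by positivity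
  have hγ1 : γ⁻¹ * γ = 1 := inv_mul_cancel₀ (by positivity)
  have hn' : (n : ℝ) ≠ 0 := by positivity
  have hs1 : -1 ≤ s := by linarith [(abs_le.1 hs).1]
  rw [designClass, Set.mem_ofPred_eq, spikedDesign_gram h hPt hP hs1, inv_smul_smul₀ hn']
  constructor
  · convert posSemidef_smul_one_add_smul hPt hP hs using 1
    rw [sub_smul, one_smul]; abel
  · convert posSemidef_smul_one_add_smul hPt hP (c := γ - 1) (s := -s)
      (by rw [abs_neg]; nlinarith) using 1
    rw [sub_smul, one_smul, neg_smul]; abel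

/-- Projecting onto the line of `ϑ` sends any basis vector with `ϑ j ≠ 0` to a nonzero multiple of
`ϑ`, so a 1-sparse vector can produce a dense target. -/
theorem exists_projection_smul_single (hd : 0 < d) (ϑ : Vec d) :
    ∃ P : Matrix (Fin d) (Fin d) ℝ, P.transpose = P ∧ P * P = P ∧
      ∃ (j : Fin d) (a : ℝ), a • P.toEuclideanLin (EuclideanSpace.single j 1) = ϑ := by
  by_cases h : ϑ = 0
  · exact ⟨0, by simp, by simp, ⟨0, hd⟩, 0, by simp [h]⟩
  obtain ⟨j, hj⟩ : ∃ j, ϑ j ≠ 0 := by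
    by_contra! hc
    exact h (PiLp.ext hc)
  have hN : ‖ϑ‖ ^ 2 ≠ 0 := by simpa using h
  refine ⟨(‖ϑ‖ ^ 2)⁻¹ • Matrix.vecMulVec ϑ ϑ, ?_, ?_, j, ‖ϑ‖ ^ 2 / ϑ j, ?_⟩
  · rw [Matrix.transpose_smul, Matrix.transpose_vecMulVec]
  · have hdot : ϑ.ofLp ⬝ᵥ ϑ.ofLp = ‖ϑ‖ ^ 2 := by
      rw [EuclideanSpace.real_norm_sq_eq]
      simp [dotProduct, sq]
    rw [Matrix.smul_mul, Matrix.mul_smul, Matrix.vecMulVec_mul_vecMulVec, hdot,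
      Matrix.vecMulVec_smul, inv_smul_smul₀ hN]
  · ext i
    simp [Matrix.toLpLin_apply, Matrix.mulVec_single, Matrix.vecMulVec_apply]
    field_simp

end Designs

/-! ### Balanced design pairs and arbitrary targets -/

section Balanced

variable {n d : ℕ}

/-- The designs of two tasks whose weighted Gram matrices average to the identity. -/
noncomputable def balancedDesigns (n : ℕ) (w : Fin 2 → ℝ) (P : Matrix (Fin d) (Fin d) ℝ) (ε : ℝ) :
    Fin 2 → Matrix (Fin n) (Fin d) ℝ :=
  ![spikedDesign n P (w 1 * ε), spikedDesign n P (-(w 0 * ε))]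

variable {w : Fin 2 → ℝ} {P : Matrix (Fin d) (Fin d) ℝ} {ε : ℝ}

theorem abs_weight_mul_le (hw : w ∈ stdSimplex ℝ (Fin 2)) (hε : 0 ≤ ε) (k : Fin 2) :
    |w k * ε| ≤ ε := by
  have h1 : w k ≤ 1 := by
    rw [← hw.2]
    exact Finset.single_le_sum (fun i _ => hw.1 i) (Finset.mem_univ k)
  rw [abs_of_nonneg (mul_nonneg (hw.1 k) hε)]
  exact mul_le_of_le_one_left hε h1

theorem balancedDesigns_mem_designClass (h : d ≤ n) (hn : 0 < n) (hPt : P.transpose = P)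
    (hP : P * P = P) (hw : w ∈ stdSimplex ℝ (Fin 2)) {γ : ℝ} (hγ : 1 < γ) (hε : 0 ≤ ε)
    (hεγ : ε ≤ 1 - γ⁻¹) (k : Fin 2) : balancedDesigns n w P ε k ∈ designClass n d γ := by
  fin_cases k
  · exact spikedDesign_mem_designClass h hn hPt hP hγ ((abs_weight_mul_le hw hε 1).trans hεγ)
  · refine spikedDesign_mem_designClass h hn hPt hP hγ ?_
    rw [abs_neg]
    exact (abs_weight_mul_le hw hε 0).trans hεγ

theorem balancedDesigns_gram (h : d ≤ n) (hPt : P.transpose = P) (hP : P * P = P)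
    (hw : w ∈ stdSimplex ℝ (Fin 2)) (hε : 0 ≤ ε) (hε1 : ε ≤ 1) :
    (balancedDesigns n w P ε 0).transpose * balancedDesigns n w P ε 0
        = (n : ℝ) • (1 + (w 1 * ε) • P) ∧
      (balancedDesigns n w P ε 1).transpose * balancedDesigns n w P ε 1
        = (n : ℝ) • (1 + (-(w 0 * ε)) • P) := by
  have h0 := abs_le.1 (abs_weight_mul_le hw hε 0)
  have h1 := abs_le.1 (abs_weight_mul_le hw hε 1)
  exact ⟨spikedDesign_gram h hPt hP (by linarith), spikedDesign_gram h hPt hP (by linarith)⟩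

theorem sum_balancedDesigns_gram (h : d ≤ n) (hn : 0 < n) (hPt : P.transpose = P) (hP : P * P = P)
    (hw : w ∈ stdSimplex ℝ (Fin 2)) (hε : 0 ≤ ε) (hε1 : ε ≤ 1) :
    ∑ k, (w k * (n : ℝ)⁻¹) • ((balancedDesigns n w P ε k).transpose * balancedDesigns n w P ε k)
      = 1 := by
  have hn' : (n : ℝ) ≠ 0 := by positivity
  obtain ⟨h0, h1⟩ := balancedDesigns_gram h hPt hP hw hε hε1
  have hsum : w 0 + w 1 = 1 := by simpa using hw.2
  rw [Fin.sum_univ_two, h0, h1, smul_smul, smul_smul, inv_mul_cancel_right₀ hn',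
    inv_mul_cancel_right₀ hn', smul_add, smul_add, smul_smul, smul_smul, add_add_add_comm,
    ← add_smul, ← add_smul, hsum,
    show w 0 * (w 1 * ε) + w 1 * -(w 0 * ε) = 0 by ring, zero_smul, one_smul, add_zero]

theorem single_mem_oneSparse (j : Fin d) (t : ℝ) : EuclideanSpace.single j t ∈ oneSparse d := by
  rw [oneSparse, Set.mem_ofPred_eq]
  refine (Set.ncard_le_ncard (t := {j}) ?_ (Set.finite_singleton j)).trans (by simp)
  intro i hi
  by_contra hij
  exact hi (by simp [show i ≠ j from hij])

/-- Opposite large multiples of a basis vector make the population minimizer an arbitrary multiple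
of the image of that vector under `P`. -/
theorem exists_oneSparse_crossMoment_eq (h : d ≤ n) (hn : 0 < n) (hPt : P.transpose = P)
    (hP : P * P = P) (hw : w ∈ stdSimplex ℝ (Fin 2)) (hw0 : ∀ k, 0 < w k) (hε : 0 < ε)
    (hε1 : ε ≤ 1) (j : Fin d) (a : ℝ) :
    ∃ β : Fin 2 → Vec d, (∀ k, β k ∈ oneSparse d) ∧
      crossMoment w (balancedDesigns n w P ε)
        (fun k => (balancedDesigns n w P ε k).toEuclideanLin (β k)) =
      a • P.toEuclideanLin (EuclideanSpace.single j 1) := by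
  have hn' : (n : ℝ) ≠ 0 := by positivity
  have hw0' := (hw0 0).ne'
  have hw1' := (hw0 1).ne'
  obtain ⟨h0, h1⟩ := balancedDesigns_gram h hPt hP hw hε.le hε1
  have hsum : w 0 + w 1 = 1 := by simpa using hw.2
  -- After weighting, the identity parts `± a / ε` cancel, and the `P` parts add up to `a * (w 1 + w
  -- 0) = a`.
  refine ⟨![EuclideanSpace.single j (a / ε / w 0), EuclideanSpace.single j (-(a / ε / w 1))], ?_, ?_⟩
  · intro k
    fin_cases k <;> exact single_mem_oneSparse _ _
  have hs : ∀ t : ℝ, (EuclideanSpace.single j t : Vec d) = t • EuclideanSpace.single j 1 := by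
    intro t
    ext i
    by_cases hi : i = j <;> simp [hi]
  rw [crossMoment_apply, Fin.sum_univ_two, ← toEuclideanLin_mul_apply, ← toEuclideanLin_mul_apply,
    h0, h1, Matrix.cons_val_zero, Matrix.cons_val_one, Matrix.cons_val_fin_one, hs, hs (-_)]
  set e : Vec d := EuclideanSpace.single j 1
  have hone : (1 : Matrix (Fin d) (Fin d) ℝ).toEuclideanLin e = e := by simp
  simp only [map_smul, map_add, LinearMap.smul_apply, LinearMap.add_apply, hone]
  match_scalars
  · field_simp
    ring
  · field_simp
    linear_combination a * hsum

theorem continuous_balancedDesigns (n : ℕ) (w : Fin 2 → ℝ) (P : Matrix (Fin d) (Fin d) ℝ) :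
    Continuous (balancedDesigns n w P) := by
  refine continuous_pi fun k => ?_
  fin_cases k <;>
  · simp only [balancedDesigns, spikedDesign]
    simp
    fun_prop

theorem continuous_crossMoment_balancedDesigns (n : ℕ) (w : Fin 2 → ℝ)
    (P : Matrix (Fin d) (Fin d) ℝ) (y : Fin 2 → Vec n) :
    Continuous (fun ε => crossMoment w (balancedDesigns n w P ε) y) := by
  have h := fun k => (continuous_apply k).comp (continuous_balancedDesigns n w P)
  simp only [crossMoment_apply, Matrix.toLpLin_apply]
  refine continuous_finsetSum _ fun k _ => ?_
  have hk := (PiLp.continuous_toLp 2 _).comp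
    ((h k).matrix_transpose.matrix_mulVec (continuous_const (y := (y k).ofLp)))
  exact hk.const_smul (w k * (n : ℝ)⁻¹)

theorem balancedDesigns_zero (n : ℕ) (w : Fin 2 → ℝ) (P : Matrix (Fin d) (Fin d) ℝ) (k : Fin 2) :
    balancedDesigns n w P 0 k = √n • partialIdentity n d := by
  fin_cases k <;> simp [balancedDesigns, spikedDesign]

end Balanced

/-! ### Law of the noise cross moment -/

section Noise

variable {n d : ℕ}

theorem charFun_scaled_multivariateGaussian (σ : ℝ) (t : Vec n) :
    charFun (multivariateGaussian 0 (σ ^ 2 • (1 : Matrix (Fin n) (Fin n) ℝ))) t =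
      Complex.exp (-(σ ^ 2 * ‖t‖ ^ 2 : ℝ) / 2) := by
  rw [charFun_multivariateGaussian (Matrix.PosSemidef.one.smul (sq_nonneg σ))]
  congr 1
  rw [Matrix.smul_mulVec, Matrix.one_mulVec, dotProduct_smul, inner_zero_right,
    EuclideanSpace.real_norm_sq_eq]
  simp [dotProduct, sq, neg_div]

/-- If both Gram matrices are `n • 1`, the cross moment of the noise is isotropic Gaussian. -/
theorem map_crossMoment_noiseLaw (hn : 0 < n) (σ : ℝ) (w : Fin 2 → ℝ)
    {X : Fin 2 → Matrix (Fin n) (Fin d) ℝ}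
    (hX : ∀ k, (X k).transpose * X k = (n : ℝ) • 1) :
    (noiseLaw n σ).map (crossMoment w X) =
      (stdGaussian (Vec d)).map (fun z => √(σ ^ 2 * (∑ k, w k ^ 2) / n) • z) := by
  have hn' : (n : ℝ) ≠ 0 := by positivity
  have hc : Continuous (crossMoment w X) := LinearMap.continuous_of_finiteDimensional _
  have : IsProbabilityMeasure (noiseLaw n σ) := by unfold noiseLaw; infer_instance
  have := Measure.isProbabilityMeasure_map (μ := noiseLaw n σ) hc.aemeasurable
  have := Measure.isProbabilityMeasure_map (μ := stdGaussian (Vec d))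
    (f := fun z => √(σ ^ 2 * (∑ k, w k ^ 2) / n) • z) (by fun_prop)
  apply Measure.ext_of_charFun
  ext t
  have hnorm : ∀ k, ‖(X k).toEuclideanLin t‖ ^ 2 = n * ‖t‖ ^ 2 := by
    intro k
    rw [← real_inner_self_eq_norm_sq, inner_toEuclideanLin_left, ← toEuclideanLin_mul_apply, hX]
    simp [inner_smul_right]
  rw [charFun_map_smul, charFun_stdGaussian, charFun_apply,
    integral_map hc.aemeasurable (by fun_prop)]
  -- Moving each design onto `t` by its adjoint splits the exponential over the two independent
  -- noises.
  have hin : ∀ ξ : Fin 2 → Vec n, Complex.exp ((⟪crossMoment w X ξ, t⟫ : ℂ) * Complex.I) =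
      ∏ k, Complex.exp ((⟪ξ k, (w k * (n : ℝ)⁻¹) • (X k).toEuclideanLin t⟫ : ℝ) * Complex.I) := by
    intro ξ
    have hk : ∀ k, ⟪(w k * (n : ℝ)⁻¹) • (X k).transpose.toEuclideanLin (ξ k), t⟫ =
        ⟪ξ k, (w k * (n : ℝ)⁻¹) • (X k).toEuclideanLin t⟫ := by
      intro k
      rw [inner_smul_left, inner_smul_right, real_inner_comm, ← inner_toEuclideanLin_left,
        real_inner_comm]
      simp
    rw [crossMoment_apply, sum_inner, Finset.sum_congr rfl fun k _ => hk k, Complex.ofReal_sum,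
      Finset.sum_mul, Complex.exp_sum]
  simp_rw [hin]
  rw [noiseLaw, integral_fintype_prod_eq_prod (f := fun (k : Fin 2) (x : Vec n) =>
    Complex.exp ((⟪x, (w k * (n : ℝ)⁻¹) • (X k).toEuclideanLin t⟫ : ℝ) * Complex.I))]
  simp_rw [← charFun_apply, charFun_scaled_multivariateGaussian]
  rw [← Complex.exp_sum]
  congr 1
  rw [← Complex.ofReal_pow]
  simp only [norm_smul, mul_pow, hnorm, Real.norm_eq_abs, sq_abs]
  rw [Real.sq_sqrt (by positivity), Fin.sum_univ_two, Fin.sum_univ_two]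
  push_cast
  have hn'' : (n : ℂ) ≠ 0 := by exact_mod_cast hn'
  field_simp
  ring

end Noise

/-! ### Scaled standard Gaussians -/

section ScaledGaussian

variable {d : ℕ}

theorem map_neg_map_smul_stdGaussian (τ : ℝ) :
    ((stdGaussian (Vec d)).map (fun z => τ • z)).map (fun z => -z) =
      (stdGaussian (Vec d)).map (fun z => τ • z) := by
  conv_rhs => rw [← stdGaussian_map (LinearIsometryEquiv.neg ℝ (E := Vec d))]
  rw [Measure.map_map (by fun_prop) (by fun_prop), Measure.map_map (by fun_prop) (by fun_prop)]
  congr 1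
  ext1 z
  simp

theorem map_smul_stdGaussian_absolutelyContinuous {τ : ℝ} (hτ : τ ≠ 0) :
    (stdGaussian (Vec d)).map (fun z => τ • z) ≪ volume := by
  refine ((stdGaussian_absolutelyContinuous d).map (f := fun z => τ • z) (by fun_prop)).trans ?_
  rw [Measure.map_addHaar_smul _ hτ]
  exact Measure.smul_absolutelyContinuous

theorem lintegral_enorm_sq_map_smul_stdGaussian (τ : ℝ) :
    ∫⁻ z, ‖z‖ₑ ^ 2 ∂((stdGaussian (Vec d)).map (fun z => τ • z)) = ENNReal.ofReal (τ ^ 2 * d) := by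
  rw [lintegral_map (by fun_prop) (by fun_prop)]
  simp_rw [enorm_smul, mul_pow]
  rw [lintegral_const_mul _ (by fun_prop), lintegral_enorm_sq_stdGaussian,
    ENNReal.ofReal_mul (sq_nonneg τ), ENNReal.ofReal_natCast, ← sq_abs,
    ENNReal.ofReal_pow (abs_nonneg τ), ← Real.norm_eq_abs, ofReal_norm]

end ScaledGaussian

/-! ### Reduction to the isotropic location model -/

variable {n d : ℕ}

/-- The worst-case risk of `est` over designs in `𝔛(γ)` and 1-sparse ground truths. -/
noncomputable def worstCaseRisk (γ σ : ℝ) (w : Fin 2 → ℝ)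
    (est : (Fin 2 → Matrix (Fin n) (Fin d) ℝ) → (Fin 2 → Vec n) → Vec d) : ℝ≥0∞ :=
  ⨆ (X : Fin 2 → Matrix (Fin n) (Fin d) ℝ) (_ : ∀ k, X k ∈ designClass n d γ)
    (β : Fin 2 → Vec d) (_ : ∀ k, β k ∈ oneSparse d)
    (ϑ : Vec d) (_ : ϑ ∈ populationMinimizers w X β), mse σ est X β ϑ

theorem mse_le_worstCaseRisk {γ σ : ℝ} {w : Fin 2 → ℝ}
    {est : (Fin 2 → Matrix (Fin n) (Fin d) ℝ) → (Fin 2 → Vec n) → Vec d}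
    {X : Fin 2 → Matrix (Fin n) (Fin d) ℝ} (hX : ∀ k, X k ∈ designClass n d γ)
    {β : Fin 2 → Vec d} (hβ : ∀ k, β k ∈ oneSparse d)
    {ϑ : Vec d} (hϑ : ϑ ∈ populationMinimizers w X β) :
    mse σ est X β ϑ ≤ worstCaseRisk γ σ w est :=
  le_iSup₂_of_le X hX <| le_iSup₂_of_le β hβ <| le_iSup₂_of_le ϑ hϑ le_rfl

/-- The estimator on the canonical isotropic design, as a function of the cross moment. -/
noncomputable def isotropicEstimator
    (est : (Fin 2 → Matrix (Fin n) (Fin d) ℝ) → (Fin 2 → Vec n) → Vec d) (v : Vec d) : Vec d :=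
  est (fun _ => √n • partialIdentity n d)
    (fun _ => (√n • partialIdentity n d).toEuclideanLin v)

theorem isotropic_gram (h : d ≤ n) :
    (√n • partialIdentity n d).transpose * (√n • partialIdentity n d) = (n : ℝ) • 1 := by
  rw [Matrix.transpose_smul, Matrix.smul_mul, Matrix.mul_smul, smul_smul,
    Real.mul_self_sqrt (Nat.cast_nonneg n), partialIdentity_transpose_mul_self h]

theorem isotropic_mem_designClass (h : d ≤ n) (hn : 0 < n) {γ : ℝ} (hγ : 1 < γ) :
    √n • partialIdentity n d ∈ designClass n d γ := by
  have := spikedDesign_mem_designClass (P := (0 : Matrix (Fin d) (Fin d) ℝ)) (s := 0) h hn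
    (by simp) (by simp) hγ (by simpa using inv_le_one_of_one_le₀ hγ.le)
  simpa [spikedDesign] using this

theorem crossMoment_isotropic (h : d ≤ n) (hn : 0 < n) {w : Fin 2 → ℝ}
    (hw : w ∈ stdSimplex ℝ (Fin 2)) (v : Vec d) :
    crossMoment w (fun _ => √n • partialIdentity n d)
      (fun _ => (√n • partialIdentity n d).toEuclideanLin v) = v := by
  have hn' : (n : ℝ) ≠ 0 := by positivity
  rw [crossMoment_apply]
  simp_rw [← toEuclideanLin_mul_apply, isotropic_gram h]
  rw [← Finset.sum_smul, ← Finset.sum_mul, hw.2, one_mul, map_smul, LinearMap.smul_apply,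
    inv_smul_smul₀ hn']
  simp

theorem measurable_isotropicEstimator (h : d ≤ n) (hn : 0 < n) {γ : ℝ} (hγ : 1 < γ)
    {w : Fin 2 → ℝ} {ρ : Vec d → ℝ}
    {est : (Fin 2 → Matrix (Fin n) (Fin d) ℝ) → (Fin 2 → Vec n) → Vec d}
    (hest : IsDirectlyRegularized γ w ρ est) : Measurable (isotropicEstimator est) := by
  refine (hest.measurable _ fun _ => isotropic_mem_designClass h hn hγ).comp ?_
  exact measurable_pi_lambda _ fun _ =>
    (LinearMap.continuous_of_finiteDimensional _).measurable

theorem isMinOn_isotropicEstimator (h : d ≤ n) (hn : 0 < n) {γ : ℝ} (hγ : 1 < γ)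
    {w : Fin 2 → ℝ} (hw : w ∈ stdSimplex ℝ (Fin 2)) {ρ : Vec d → ℝ}
    {est : (Fin 2 → Matrix (Fin n) (Fin d) ℝ) → (Fin 2 → Vec n) → Vec d}
    (hest : IsDirectlyRegularized γ w ρ est) (v : Vec d) :
    IsMinOn (fun η => ‖η‖ ^ 2 - 2 * ⟪η, v⟫ + ρ η) Set.univ (isotropicEstimator est v) := by
  have hgram : ∑ k : Fin 2, (w k * (n : ℝ)⁻¹) •
      ((√n • partialIdentity n d).transpose * (√n • partialIdentity n d)) = 1 := by
    rw [isotropic_gram h, ← Finset.sum_smul, ← Finset.sum_mul, hw.2, one_mul,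
      inv_smul_smul₀ (by positivity)]
  have h1 := hest.minimizes _ (fun _ => isotropic_mem_designClass h hn hγ)
    (fun _ => (√n • partialIdentity n d).toEuclideanLin v)
  rw [mem_penalizedMinimizers_iff hgram, crossMoment_isotropic h hn hw] at h1
  exact h1

/-- Along balanced designs tending to the isotropic one, 1-sparse ground truths realize any target
`ϑ`, so the worst-case risk dominates the risk at `ϑ` in the isotropic Gaussian location model. -/
theorem lintegral_isotropicEstimator_le_worstCaseRisk (h : d ≤ n) (hn : 0 < n) (hd : 0 < d)
    {γ : ℝ} (hγ : 1 < γ) {σ : ℝ} (hσ : 0 < σ) {w : Fin 2 → ℝ} (hw : w ∈ stdSimplex ℝ (Fin 2))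
    (hw0 : ∀ k, 0 < w k) {ρ : Vec d → ℝ}
    {est : (Fin 2 → Matrix (Fin n) (Fin d) ℝ) → (Fin 2 → Vec n) → Vec d}
    (hest : IsDirectlyRegularized γ w ρ est) (ϑ : Vec d) :
    ∫⁻ z, ‖isotropicEstimator est (ϑ + z) - ϑ‖ₑ ^ 2
        ∂((stdGaussian (Vec d)).map (fun z => √(σ ^ 2 * (∑ k, w k ^ 2) / n) • z)) ≤
      worstCaseRisk γ σ w est := by
  obtain ⟨P, hPt, hP, j, a, hja⟩ := exists_projection_smul_single hd ϑ
  have hγ1 : 0 < 1 - γ⁻¹ := sub_pos.2 (inv_lt_one_of_one_lt₀ hγ)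
  set ε : ℕ → ℝ := fun m => (1 - γ⁻¹) / ((m : ℝ) + 1) with hεdef
  have hε : ∀ m, 0 < ε m := fun m => by positivity
  have hεγ : ∀ m, ε m ≤ 1 - γ⁻¹ := fun m => div_le_self hγ1.le (by simp)
  have hε1 : ∀ m, ε m ≤ 1 := fun m =>
    (hεγ m).trans (sub_le_self _ (inv_nonneg.2 (by linarith)))
  have hε0 : Tendsto ε atTop (𝓝 0) := by
    simpa [hεdef, div_eq_mul_inv] using
      (tendsto_one_div_add_atTop_nhds_zero_nat (𝕜 := ℝ)).const_mul (1 - γ⁻¹)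
  set X : ℕ → Fin 2 → Matrix (Fin n) (Fin d) ℝ := fun m => balancedDesigns n w P (ε m)
  have hXmem : ∀ m k, X m k ∈ designClass n d γ := fun m k =>
    balancedDesigns_mem_designClass h hn hPt hP hw hγ (hε m).le (hεγ m) k
  have hXsum : ∀ m, ∑ k, (w k * (n : ℝ)⁻¹) • ((X m k).transpose * X m k) = 1 := fun m =>
    sum_balancedDesigns_gram h hn hPt hP hw (hε m).le (hε1 m)
  choose β hβ hβϑ using fun m =>
    exists_oneSparse_crossMoment_eq h hn hPt hP hw hw0 (hε m) (hε1 m) j a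
  have hpop : ∀ m, ϑ ∈ populationMinimizers w (X m) (β m) := fun m => by
    have := crossMoment_mem_populationMinimizers (hXsum m) (β m)
    rwa [hβϑ m, hja] at this
  set X₀ : Fin 2 → Matrix (Fin n) (Fin d) ℝ := fun _ => √n • partialIdentity n d
  have hX₀ : balancedDesigns n w P 0 = X₀ := funext fun k => balancedDesigns_zero n w P k
  have hlaw := map_crossMoment_noiseLaw hn σ w (X := X₀) fun _ => isotropic_gram h
  have hcont : Continuous (crossMoment w X₀) := LinearMap.continuous_of_finiteDimensional _
  have hT := measurable_isotropicEstimator h hn hγ hest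
  have hτ : √(σ ^ 2 * (∑ k, w k ^ 2) / n) ≠ 0 := by
    have h1 : 0 < ∑ k, w k ^ 2 := Finset.sum_pos (fun k _ => pow_pos (hw0 k) 2) ⟨0, by simp⟩
    positivity
  have hae := ae_tendsto_minimizers volume ρ (isotropicEstimator est)
    (isMinOn_isotropicEstimator h hn hγ hw hest)
  -- The exceptional null set is translated by `ϑ`, is then null for the Gaussian by absolute
  -- continuity, and is finally pulled back to the noise space.
  have hae' := (measurePreserving_add_left volume ϑ).quasiMeasurePreserving.ae hae
  have hae'' := (map_smul_stdGaussian_absolutelyContinuous hτ).ae_le hae'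
  rw [← hlaw] at hae'' ⊢
  have hae₃ := ae_of_ae_map hcont.aemeasurable hae''
  rw [lintegral_map (by fun_prop) hcont.measurable]
  have hresp : ∀ m ξ, crossMoment w (X m) (responses (X m) (β m) ξ) =
      ϑ + crossMoment w (X m) ξ := by
    intro m ξ
    rw [← hja, ← hβϑ m, ← map_add]
    rfl
  -- For fixed `ξ`, all designs pose the same penalized problem at cross moments converging to `ϑ +
  -- crossMoment w X₀ ξ`, although `β m` may diverge.
  have hlim : ∀ᵐ ξ ∂(noiseLaw n σ), Tendsto
      (fun m => ‖est (X m) (responses (X m) (β m) ξ) - ϑ‖ₑ ^ 2) atTop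
      (𝓝 (‖isotropicEstimator est (ϑ + crossMoment w X₀ ξ) - ϑ‖ₑ ^ 2)) := by
    filter_upwards [hae₃] with ξ hξ
    have h1 := hξ (fun m => ϑ + crossMoment w (X m) ξ)
      (fun m => est (X m) (responses (X m) (β m) ξ)) ?_ ?_
    · exact ((ENNReal.continuous_pow 2).comp continuous_enorm).continuousAt.tendsto.comp
        (h1.sub_const ϑ)
    · refine Tendsto.const_add ϑ ?_
      rw [← hX₀]
      exact ((continuous_crossMoment_balancedDesigns n w P ξ).tendsto 0).comp hε0
    · intro m
      have h2 := hest.minimizes (X m) (hXmem m) (responses (X m) (β m) ξ)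
      rwa [mem_penalizedMinimizers_iff (hXsum m), hresp] at h2
  have hmeas : ∀ m, Measurable
      (fun ξ => ‖est (X m) (responses (X m) (β m) ξ) - ϑ‖ₑ ^ 2) := by
    intro m
    have h1 : Measurable (responses (X m) (β m)) :=
      measurable_pi_lambda _ fun k => (measurable_pi_apply k).const_add _
    have h2 := (hest.measurable (X m) (hXmem m)).comp h1
    exact (h2.sub_const ϑ).enorm.pow_const 2
  -- Fatou's lemma suffices: only an upper bound on the limiting risk is needed.
  calc ∫⁻ ξ, ‖isotropicEstimator est (ϑ + crossMoment w X₀ ξ) - ϑ‖ₑ ^ 2 ∂(noiseLaw n σ)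
      = ∫⁻ ξ, liminf (fun m => ‖est (X m) (responses (X m) (β m) ξ) - ϑ‖ₑ ^ 2) atTop
          ∂(noiseLaw n σ) := lintegral_congr_ae (hlim.mono fun ξ hξ => hξ.liminf_eq.symm)
    _ ≤ liminf (fun m => mse σ est (X m) (β m) ϑ) atTop := lintegral_liminf_le hmeas
    _ ≤ worstCaseRisk γ σ w est := by
      refine liminf_le_of_frequently_le' (Frequently.of_forall fun m => ?_)
      exact mse_le_worstCaseRisk (hXmem m) (hβ m) (hpop m)

theorem ofReal_le_worstCaseRisk (h : d ≤ n) (hn : 0 < n) (hd : 0 < d)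
    {γ : ℝ} (hγ : 1 < γ) {σ : ℝ} (hσ : 0 < σ) {w : Fin 2 → ℝ} (hw : w ∈ stdSimplex ℝ (Fin 2))
    (hw0 : ∀ k, 0 < w k) {ρ : Vec d → ℝ}
    {est : (Fin 2 → Matrix (Fin n) (Fin d) ℝ) → (Fin 2 → Vec n) → Vec d}
    (hest : IsDirectlyRegularized γ w ρ est) :
    ENNReal.ofReal (1 / 4 * (σ ^ 2 * d / (n * γ))) ≤ worstCaseRisk γ σ w est := by
  have := Measure.isProbabilityMeasure_map (μ := stdGaussian (Vec d))
    (f := fun z => √(σ ^ 2 * (∑ k, w k ^ 2) / n) • z) (by fun_prop)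
  have h1 := lintegral_enorm_sq_le_two_mul_of_forall_risk_le
    ((stdGaussian (Vec d)).map (fun z => √(σ ^ 2 * (∑ k, w k ^ 2) / n) • z))
    (map_neg_map_smul_stdGaussian _) (measurable_isotropicEstimator h hn hγ hest)
    (lintegral_isotropicEstimator_le_worstCaseRisk h hn hd hγ hσ hw hw0 hest)
  rw [lintegral_enorm_sq_map_smul_stdGaussian, Real.sq_sqrt (by positivity)] at h1
  have hsum : w 0 + w 1 = 1 := by simpa using hw.2
  have hsq : 1 / 2 ≤ ∑ k, w k ^ 2 := by
    rw [Fin.sum_univ_two]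
    nlinarith [sq_nonneg (w 0 - w 1)]
  -- The constant `1 / 4` combines the factor 2 from the exchange argument with `∑ k, w k ^ 2 ≥ 1 /
  -- 2`; dividing by `γ > 1` only weakens the bound.
  have hle : 2 * (1 / 4 * (σ ^ 2 * d / (n * γ))) ≤ σ ^ 2 * (∑ k, w k ^ 2) / n * d := by
    have hn' : (0 : ℝ) < n := by positivity
    calc 2 * (1 / 4 * (σ ^ 2 * d / (n * γ))) = σ ^ 2 * (1 / 2) / n * d / γ := by
          field_simp
          norm_num
      _ ≤ σ ^ 2 * (1 / 2) / n * d := div_le_self (by positivity) hγ.le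
      _ ≤ σ ^ 2 * (∑ k, w k ^ 2) / n * d := by gcongr
  have h2 := (ENNReal.ofReal_le_ofReal hle).trans h1
  rw [ENNReal.ofReal_mul zero_le_two, ENNReal.ofReal_ofNat] at h2
  exact (ENNReal.mul_le_mul_iff_right (by simp) (by simp)).1 h2

end DirectReg

theorem mainTheorem4 :
    ∃ c : ℝ, 0 < c ∧
      ∀ (n d : ℕ), d ≤ n →
      ∀ (γ : ℝ), 1 < γ →
      ∀ (σ : ℝ), 0 ≤ σ → σ ^ 2 ≤ 2 * n * γ ^ 2 / (d + 1) →
      ∀ (w : Fin 2 → ℝ), w ∈ stdSimplex ℝ (Fin 2) → (∀ k, 0 < w k) →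
      ∀ (ρ : DirectReg.Vec d → ℝ)
        (est : (Fin 2 → Matrix (Fin n) (Fin d) ℝ) → (Fin 2 → DirectReg.Vec n) → DirectReg.Vec d),
        DirectReg.IsDirectlyRegularized γ w ρ est →
        ENNReal.ofReal (c * (σ ^ 2 * d / (n * γ))) ≤
          ⨆ (X : Fin 2 → Matrix (Fin n) (Fin d) ℝ) (_ : ∀ k, X k ∈ DirectReg.designClass n d γ)
            (β : Fin 2 → DirectReg.Vec d) (_ : ∀ k, β k ∈ DirectReg.oneSparse d)
            (ϑ : DirectReg.Vec d) (_ : ϑ ∈ DirectReg.populationMinimizers w X β),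
            DirectReg.mse σ est X β ϑ := by
  refine ⟨1 / 4, by norm_num, fun n d h γ hγ σ hσ _ w hw hw0 ρ est hest => ?_⟩
  -- The bound is zero when `σ = 0` or `d = 0`; absolute continuity of the noise needs `σ > 0`.
  rcases hσ.eq_or_lt with rfl | hσ
  · simp
  rcases Nat.eq_zero_or_pos d with rfl | hd
  · simp
  exact DirectReg.ofReal_le_worstCaseRisk h (hd.trans_le h) hd hγ hσ hw hw0 hest
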